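/- **Infinite words.** Let $n\ge 1$ and order $\mathbb Z^n$ by the right lexicographic order (tuples are compared at the last coordinate at which they differ); its least positive element is $1_A=(1,0,\dots,0)$. Let $X$ be a set and $X^{\pm}=X\cup X^{-1}$. A word is a function $w:[1_A,\alpha]\to X^{\pm}$ with $\alpha\in\mathbb Z^n$, $\alpha\ge 0$; its length is $|w|=\alpha$. Concatenation and inversion of words are the usual ones. A word is reduced if it contains no letter immediately followed by its inverse. For reduced words $u,v$, the word $\mathrm{com}(u,v)$ is the longest common initial segment, when it exists: $u=\mathrm{com}(u,v)\tilde u$ and $v=\mathrm{com}(u,v)\tilde v$, where $\tilde u,\tilde v$ do not begin with the same letter. The product $u*v$ is defined if and only if $c=\mathrm{com}(u^{-1},v)$ exists; then $u^{-1}=c\,\tilde u$, $v=c\,\tilde v$ and $u*v=\tilde u^{-1}\tilde v$. A reduced word is cyclically reduced if its last letter is not the inverse of its first letter (the empty word is cyclically reduced), and $CDR(\mathbb Z^n,X)$ is the set of reduced words of the form $c^{-1}uc$ (concatenation) with $c$ reduced and $u$ cyclically reduced. Let $G$ be a subgroup of $CDR(\mathbb Z^n,X)$, that is, a subset on which $*$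 is everywhere defined and is a group operation. For $g\in G$ let $\lambda(g)\in\mathbb Z$ be the last coordinate of $|g|$; likewise for any word. **Reduced sets.** For $Z\subset G$ put $Z_+=\{g\in Z:\lambda(g)>0\}$, $Z_0=\{g\in Z:\lambda(g)=0\}$ and $Z_+^{\pm1}=Z_+\cup Z_+^{-1}$. A finite set $Z\subset G$ is called reduced if * (a) all elements of $Z_+$ are cyclically reduced; * (b) if $f,g\in Z_+^{\pm1}$ and $f\ne g$, then $\lambda(\mathrm{com}(f,h*g))=0$ for all $h\in\langle Z_0\rangle$; * (c) if $f\in Z_+^{\pm1}$, $h\in\langle Z_0\rangle$ and $\lambda(\mathrm{com}(f,h*f))>0$, then $\lambda(\mathrm{com}(f,h*f))=\lambda(f)$; * (d) if $f\in Z_+^{\pm1}$, $h\in\langle Z_0\rangle$ and $\lambda(\mathrm{com}(f,h*f))>0$, then $\lambda(\mathrm{com}(f,h*f))=\lambda(f)$ and $f^{-1}*h*f\in\langle Z_0\rangle$. **Pregroups.** A pregroup is a set $P$ with an element $1$, an involution $x\mapsto x^{-1}$ and a partial multiplication such that: $1x$ and $x1$ are defined and equal $x$; $x^{-1}x$ and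 $xx^{-1}$ are defined and equal $1$; if $xy$ is defined then $y^{-1}x^{-1}$ is defined and equals $(xy)^{-1}$; if $xy$ and $yz$ are defined, then $(xy)z$ is defined if and only if $x(yz)$ is, and then they are equal; if $wx$, $xy$, $yz$ are defined, then $(wx)y$ or $(xy)z$ is defined. Its universal group is $U(P)=\langle P\mid xy=z \text{ whenever } xy \text{ is defined in } P \text{ and equals } z\rangle$. A finite sequence $(g_1,\dots,g_k)$ in $P$ is reduced if no product $g_ig_{i+1}$ ($1\le i<k$) is defined. **Theorem.** Let $Z$ be a finite reduced generating set of $G$, and let $$P_Z=\{g*f*h : f\in Z_+^{\pm1},\ g,h\in\langle Z_0\rangle\}\cup\langle Z_0\rangle ,$$ with inversion as in $G$ and with the partial multiplication for which the product of $p,q\in P_Z$ is defined if and only if $p*q\in P_Z$, and then equals $p*q$. Then: 1. $P_Z$ is a pregroup. 2. The inclusion $P_Z\to G$ extends to a group isomorphism $U(P_Z)\to G$. 3. If $(g_1,\dots,g_k)$ is a reduced sequence in $P_Z$ and $g=g_1*\cdots*g_k$ in $G$, then $\lambda(g)=\sum_{i=1}^k\lambda(g_i)$. -/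

import Mathlib

/-! ## Discretely ordered abelian groups and `ℤ^(n+1)` with the right lexicographic order -/

/-- A discretely ordered abelian group: `unit` (written `1_A`) is the least positive element. -/
class DiscretelyOrdered (A : Type*) [AddCommGroup A] [LinearOrder A] where
  unit : A
  unit_pos : 0 < unit
  unit_le : ∀ a : A, 0 < a → unit ≤ a

/-- The group `ℤ^(n+1)` with the right lexicographic order: tuples are compared at the
largest index at which they differ. -/
def RightLexZ (n : ℕ) : Type := Colex (Fin (n + 1) → ℤ)

namespace RightLexZ

variable {n : ℕ}

instance addCommGroup : AddCommGroup (RightLexZ n) :=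
  inferInstanceAs (AddCommGroup (Colex (Fin (n + 1) → ℤ)))

noncomputable instance linearOrder : LinearOrder (RightLexZ n) :=
  inferInstanceAs (LinearOrder (Colex (Fin (n + 1) → ℤ)))

/-- The tuple as an element of the ordered group. -/
def ofTuple (x : Fin (n + 1) → ℤ) : RightLexZ n := toColex x

/-- The `i`-th coordinate. -/
def coord (i : Fin (n + 1)) (a : RightLexZ n) : ℤ := ofColex a i

@[simp] theorem coord_ofTuple (i : Fin (n + 1)) (x : Fin (n + 1) → ℤ) :
    coord i (ofTuple x) = x i := rfl

@[simp] theorem coord_zero (i : Fin (n + 1)) : coord i (0 : RightLexZ n) = 0 := rfl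

@[simp] theorem coord_add (i : Fin (n + 1)) (a b : RightLexZ n) :
    coord i (a + b) = coord i a + coord i b := rfl

theorem ext_coord {a b : RightLexZ n} (h : ∀ i, coord i a = coord i b) : a = b := funext h

theorem lt_iff {a b : RightLexZ n} :
    a < b ↔ ∃ i, (∀ j, i < j → coord j a = coord j b) ∧ coord i a < coord i b := Iff.rfl

instance isOrderedAddMonoid : IsOrderedAddMonoid (RightLexZ n) where
  add_le_add_left a b hab c := by
    rcases hab.lt_or_eq with h | h
    · obtain ⟨i, hi, hlt⟩ := lt_iff.mp h
      refine le_of_lt (lt_iff.mpr ⟨i, fun j hj => ?_, ?_⟩)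
      · rw [coord_add, coord_add, hi j hj]
      · rw [coord_add, coord_add]
        exact add_lt_add_left hlt (coord i c)
    · rw [h]

/-- The least positive element of `ℤ^(n+1)` is the first basis vector `(1, 0, …, 0)`. -/
instance discretelyOrdered : DiscretelyOrdered (RightLexZ n) where
  unit := ofTuple (Pi.single 0 1)
  unit_pos := lt_iff.mpr ⟨0, fun j hj => by simp [Pi.single_eq_of_ne (ne_of_gt hj)], by simp⟩
  unit_le a ha := by
    obtain ⟨i, hi, hlt⟩ := lt_iff.mp ha
    simp only [coord_zero] at hi hlt
    rcases eq_or_ne i 0 with rfl | h0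
    · rcases (show (1 : ℤ) ≤ coord 0 a from hlt).lt_or_eq with h | h
      · refine le_of_lt (lt_iff.mpr ⟨0, fun j hj => ?_, by simpa using h⟩)
        simp [Pi.single_eq_of_ne (ne_of_gt hj), ← hi j hj]
      · refine le_of_eq (ext_coord fun j => ?_)
        rcases eq_or_ne j 0 with rfl | hj
        · simpa using h
        · simp [Pi.single_eq_of_ne hj, ← hi j (Fin.pos_of_ne_zero hj)]
    · refine le_of_lt (lt_iff.mpr ⟨i, fun j hj => ?_, by simpa [Pi.single_eq_of_ne h0] using hlt⟩)
      have hj0 : j ≠ 0 := ne_of_gt (lt_of_le_of_lt (Fin.zero_le i) hj)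
      simp [Pi.single_eq_of_ne hj0, ← hi j hj]

end RightLexZ

theorem DiscretelyOrdered.unit_le_iff {A : Type*} [AddCommGroup A] [LinearOrder A]
    [DiscretelyOrdered A] {a : A} : (DiscretelyOrdered.unit : A) ≤ a ↔ 0 < a :=
  ⟨fun h => lt_of_lt_of_le DiscretelyOrdered.unit_pos h, DiscretelyOrdered.unit_le a⟩

/-! ## Infinite words -/

/-- The alphabet `X^± = X ∪ X⁻¹`; `(x, true)` is the letter `x` and `(x, false)` is `x⁻¹`. -/
abbrev SignedLetter (X : Type*) : Type _ := X × Bool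

/-- The formal inverse of a letter. -/
def SignedLetter.inv {X : Type*} (a : SignedLetter X) : SignedLetter X := (a.1, !a.2)

/-- An `A`-word over `X`: a function `[1_A, len] → X^±` with `0 ≤ len`, coded as a partial
function on `A` (value `none` outside its domain) with domain exactly `[1_A, len]`. -/
structure AWord (A X : Type*) [AddCommGroup A] [LinearOrder A] [DiscretelyOrdered A] where
  len : A
  len_nonneg : 0 ≤ len
  letter : A → Option (SignedLetter X)
  isSome_letter_iff : ∀ a : A,
    (letter a).isSome ↔ (DiscretelyOrdered.unit : A) ≤ a ∧ a ≤ len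

namespace AWord

variable {A X : Type*} [AddCommGroup A] [LinearOrder A] [IsOrderedAddMonoid A]
  [DiscretelyOrdered A]

/-- Concatenation `u v`: it is `u(a)` for `a ≤ |u|` and `v(a - |u|)` for `a > |u|`. -/
def concat (u v : AWord A X) : AWord A X where
  len := u.len + v.len
  len_nonneg := add_nonneg u.len_nonneg v.len_nonneg
  letter a := if a ≤ u.len then u.letter a else v.letter (a - u.len)
  isSome_letter_iff a := by
    split_ifs with h
    · rw [u.isSome_letter_iff]
      exact ⟨fun k => ⟨k.1, k.2.trans (le_add_of_nonneg_right v.len_nonneg)⟩, fun k => ⟨k.1, h⟩⟩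
    · rw [v.isSome_letter_iff, DiscretelyOrdered.unit_le_iff, DiscretelyOrdered.unit_le_iff,
        sub_pos, sub_le_iff_le_add']
      exact ⟨fun k => ⟨lt_of_le_of_lt u.len_nonneg k.1, k.2⟩, fun k => ⟨not_le.mp h, k.2⟩⟩

/-- The inverse word `u⁻¹`: it has the same length and `u⁻¹(a) = u(|u| + 1_A - a)⁻¹`. -/
def inverse (u : AWord A X) : AWord A X where
  len := u.len
  len_nonneg := u.len_nonneg
  letter a := (u.letter (u.len + DiscretelyOrdered.unit - a)).map SignedLetter.inv
  isSome_letter_iff a := by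
    rw [Option.isSome_map, u.isSome_letter_iff, le_sub_iff_add_le, sub_le_iff_le_add,
      add_comm (DiscretelyOrdered.unit : A) a, add_le_add_iff_right, add_le_add_iff_left, and_comm]

/-- A word is reduced if no letter is followed by its inverse. -/
def IsReduced (w : AWord A X) : Prop :=
  ∀ b : A, (DiscretelyOrdered.unit : A) ≤ b → b < w.len →
    w.letter (b + DiscretelyOrdered.unit) ≠ (w.letter b).map SignedLetter.inv

/-- The words `u` and `v` do not start with the same letter (true if one of them is empty). -/
def DifferentStart (u v : AWord A X) : Prop :=
  ∀ x : SignedLetter X, u.letter DiscretelyOrdered.unit = some x →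
    v.letter DiscretelyOrdered.unit ≠ some x

/-- `c` is the longest common initial segment `com(u, v)`: `u = c ũ` and `v = c ṽ`, where
`ũ` and `ṽ` do not start with the same letter. -/
def IsCom (u v c : AWord A X) : Prop :=
  ∃ u' v' : AWord A X, u = c.concat u' ∧ v = c.concat v' ∧ DifferentStart u' v'

/-- The partial multiplication of reduced words, as a relation: `u ∗ v` is defined and equal
to `w`. That is, `com(u⁻¹, v)` exists, `u⁻¹ = com(u⁻¹, v) ũ`, `v = com(u⁻¹, v) ṽ`, and
`w = ũ⁻¹ ṽ`. -/
def IsProduct (u v w : AWord A X) : Prop :=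
  ∃ c u' v' : AWord A X, u.inverse = c.concat u' ∧ v = c.concat v' ∧ DifferentStart u' v' ∧
    w = u'.inverse.concat v'

/-- A reduced word is cyclically reduced if its last letter is not the inverse of its first
letter (the empty word is cyclically reduced). -/
def IsCyclicallyReduced (v : AWord A X) : Prop :=
  v.IsReduced ∧ ∀ x : SignedLetter X, v.letter DiscretelyOrdered.unit = some x →
    v.letter v.len ≠ some x.inv

variable (A X) in
/-- `CDR(A, X)`: the reduced words that admit a cyclic decomposition `c⁻¹ ∘ u ∘ c` with
`u` cyclically reduced. -/
def CDR : Set (AWord A X) :=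
  {v | v.IsReduced ∧ ∃ c u : AWord A X, c.IsReduced ∧ u.IsCyclicallyReduced ∧
    v = c.inverse.concat (u.concat c)}

/-- The top coordinate of the length of a word over `ℤ^(n+1)`. -/
def topLength {n : ℕ} (w : AWord (RightLexZ n) X) : ℤ := RightLexZ.coord (Fin.last n) w.len

end AWord

/-- A realization of the group `G` as a subgroup of `CDR(A, X)`: an injective map `G → CDR(A, X)`
such that the product of any two words in the image is defined and corresponds to the product
in `G`. -/
structure CDREmbedding (A X G : Type*) [AddCommGroup A] [LinearOrder A] [IsOrderedAddMonoid A]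
    [DiscretelyOrdered A] [Group G] where
  word : G → AWord A X
  injective_word : Function.Injective word
  word_mem : ∀ g : G, word g ∈ AWord.CDR A X
  word_mul : ∀ g h : G, AWord.IsProduct (word g) (word h) (word (g * h))

/-! ## Pregroups and their universal groups -/

/-- A set with a distinguished element, a unary operation and a partial multiplication;
`mul x y = some z` means that the product of `x` and `y` is defined and equal to `z`. -/
structure PartialMultiplication (P : Type*) where
  one : P
  inv : P → P
  mul : P → P → Option P

namespace PartialMultiplication

variable {P : Type*} (S : PartialMultiplication P)

/-- Stallings' axioms of a pregroup. -/
structure IsPregroup : Prop where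
  inv_inv : ∀ x, S.inv (S.inv x) = x
  one_mul : ∀ x, S.mul S.one x = some x
  mul_one : ∀ x, S.mul x S.one = some x
  inv_mul : ∀ x, S.mul (S.inv x) x = some S.one
  mul_inv : ∀ x, S.mul x (S.inv x) = some S.one
  mul_inv_rev : ∀ x y z, S.mul x y = some z → S.mul (S.inv y) (S.inv x) = some (S.inv z)
  /-- If `xy` and `yz` are defined, then `(xy)z` is defined if and only if `x(yz)` is, and in
  that case they are equal. -/
  assoc : ∀ x y z a b, S.mul x y = some a → S.mul y z = some b → S.mul a z = S.mul x b
  /-- If `wx`, `xy` and `yz` are defined, then `(wx)y` or `(xy)z` is defined. -/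
  four : ∀ w x y z a b c, S.mul w x = some a → S.mul x y = some b → S.mul y z = some c →
    (S.mul a y).isSome ∨ (S.mul b z).isSome

/-- The defining relators `x y z⁻¹` of the universal group, one for each defined product
`xy = z`. -/
def relators : Set (FreeGroup P) :=
  {r | ∃ x y z : P, S.mul x y = some z ∧
    r = FreeGroup.of x * FreeGroup.of y * (FreeGroup.of z)⁻¹}

/-- The universal group `U(P) = ⟨P | xy = z whenever xy is defined and equal to z⟩`. -/
abbrev UniversalGroup : Type _ := PresentedGroup S.relators

/-- The canonical map `P → U(P)`. -/
def toUniversal (x : P) : S.UniversalGroup := PresentedGroup.of x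

/-- A finite sequence is reduced if no product of two consecutive terms is defined. -/
def IsReducedSeq (L : List P) : Prop := L.IsChain fun x y => S.mul x y = none

open Classical in
/-- The partial multiplication that a group induces on a subset `P` which contains `1` and is
closed under inversion: the product of `p` and `q` is defined if and only if `p * q ∈ P`. -/
noncomputable def induced {G : Type*} [Group G] (P : Set G) (h1 : (1 : G) ∈ P)
    (hinv : ∀ p ∈ P, p⁻¹ ∈ P) : PartialMultiplication P where
  one := ⟨1, h1⟩
  inv p := ⟨(p : G)⁻¹, hinv p p.2⟩
  mul p q := if h : (p : G) * q ∈ P then some ⟨p * q, h⟩ else none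

end PartialMultiplication

/-! ## Reduced generating sets of subgroups of `CDR(ℤ^(n+1), X)` -/

namespace CDREmbedding

variable {n : ℕ} {X G : Type*} [Group G] (φ : CDREmbedding (RightLexZ n) X G)

/-- `λ(g)`, the top coordinate of the length `|g|`. -/
def lam (g : G) : ℤ := (φ.word g).topLength

/-- `Z_+ = {g ∈ Z | λ(g) > 0}`. -/
def plusPart (Z : Set G) : Set G := {g ∈ Z | 0 < φ.lam g}

/-- `Z_+^{±1}`. -/
def plusPartPM (Z : Set G) : Set G := {g | g ∈ φ.plusPart Z ∨ g⁻¹ ∈ φ.plusPart Z}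

/-- `⟨Z_0⟩`, where `Z_0 = {g ∈ Z | λ(g) = 0}`. -/
def zeroSubgroup (Z : Set G) : Subgroup G := Subgroup.closure {g ∈ Z | φ.lam g = 0}

/-- Reduced finite subsets of `G`. The word `com(f, g)` exists and is unique for all
`f, g ∈ G`; the variable `c` below stands for it. -/
structure IsReducedSet (Z : Set G) : Prop where
  finite : Z.Finite
  cyclicallyReduced : ∀ f ∈ φ.plusPart Z, (φ.word f).IsCyclicallyReduced
  com_of_ne : ∀ f ∈ φ.plusPartPM Z, ∀ g ∈ φ.plusPartPM Z, f ≠ g → ∀ h ∈ φ.zeroSubgroup Z,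
    ∀ c, AWord.IsCom (φ.word f) (φ.word (h * g)) c → c.topLength = 0
  com_self : ∀ f ∈ φ.plusPartPM Z, ∀ h ∈ φ.zeroSubgroup Z,
    ∀ c, AWord.IsCom (φ.word f) (φ.word (h * f)) c → 0 < c.topLength → c.topLength = φ.lam f
  conj_mem : ∀ f ∈ φ.plusPartPM Z, ∀ h ∈ φ.zeroSubgroup Z,
    ∀ c, AWord.IsCom (φ.word f) (φ.word (h * f)) c → 0 < c.topLength →
      c.topLength = φ.lam f ∧ f⁻¹ * h * f ∈ φ.zeroSubgroup Z

/-- `P_Z = {g ∗ f ∗ h | f ∈ Z_+^{±1}, g, h ∈ ⟨Z_0⟩} ∪ ⟨Z_0⟩`. -/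
def pregroupSet (Z : Set G) : Set G :=
  {p | ∃ g ∈ φ.zeroSubgroup Z, ∃ f ∈ φ.plusPartPM Z, ∃ h ∈ φ.zeroSubgroup Z, p = g * f * h} ∪
    (φ.zeroSubgroup Z : Set G)

theorem one_mem_pregroupSet (Z : Set G) : (1 : G) ∈ φ.pregroupSet Z :=
  Or.inr (one_mem (φ.zeroSubgroup Z))

theorem inv_mem_pregroupSet (Z : Set G) : ∀ p ∈ φ.pregroupSet Z, p⁻¹ ∈ φ.pregroupSet Z := by
  rintro p (⟨g, hg, f, hf, h, hh, rfl⟩ | hp)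
  · refine Or.inl ⟨h⁻¹, inv_mem hh, f⁻¹, ?_, g⁻¹, inv_mem hg, by group⟩
    rcases hf with hf | hf
    · exact Or.inr (by rwa [inv_inv])
    · exact Or.inl hf
  · exact Or.inr (inv_mem (show p ∈ φ.zeroSubgroup Z from hp))

/-- `P_Z` with the partial multiplication and the inversion induced from `G`. -/
noncomputable def pregroupMul (Z : Set G) : PartialMultiplication (φ.pregroupSet Z) :=
  PartialMultiplication.induced (φ.pregroupSet Z) (φ.one_mem_pregroupSet Z)
    (φ.inv_mem_pregroupSet Z)

end CDREmbedding

/-!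
The top coordinate `λ` of the length of a word is an integer-valued Lyndon length function on
`G`: the words over `ℤ^(n+1)` satisfy `|f⁻¹ * g| = |f| + |g| - 2 |com(f, g)|`
(`CDREmbedding.exists_isCom`), longest common initial segments are ultrametric
(`AWord.IsCom.min_len_le`), and the top coordinate is additive and monotone. Geometrically, `λ`
measures displacements of the base point of a simplicial tree on which `G` acts.

Write `H = ⟨Z_0⟩` and `P = P_Z`. Then `λ` vanishes on `H`, is positive on `P \ H`, and `P` is a
union of double cosets of `H`. Twice the Gromov product, `gromov f g = λ(f) + λ(g) - λ(f⁻¹ * g)`,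
does not change when `f`, `g` are multiplied on the right, or simultaneously on the left, by
elements of `H`. Conditions (b) and (d) therefore say the following for
`p = g₁ f₁ h₁` and `q = g₂ f₂ h₂` in `P \ H`: if there is cancellation between `p` and `q` at the
level of `λ`, then `f₂ = f₁⁻¹` and `p * q ∈ H`
(`IsReducedSet.mul_mem_zeroSubgroup_of_gromov_ne_zero`). If there is none, `p * q` lies outside
`P`: otherwise `p * q` has the form `g₃ f₃ h₃` or lies in `H`; the latter is excluded by
`λ(p * q) = λ(p) + λ(q) > 0`, and in the former case `p` is an initial segment of `p * q` at the
level of `λ`, so that (b) forces `f₃ = f₁`, although `λ(f₃) = λ(f₁) + λ(f₂)`.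

So the product of two elements of `P \ H` is in `P` only if it is in `H`
(`IsReducedSet.mul_mem_zeroSubgroup_of_mem_pregroupSet`), which gives the pregroup axioms. In a
reduced sequence of at least two terms all terms are in `P \ H` and there is no cancellation
between neighbours; as in any tree, local geodesics are geodesics, whence `λ` is additive along the
sequence (`IsReducedSet.lam_prod_of_isReducedSeq`). Finally, every element of the universal group is
the product of a reduced sequence, and by additivity of `λ` a reduced sequence with product `1` in
`G` is empty or consists of the single term `1`; so
`U(P) → G` is injective, without an appeal to the normal form theorem for pregroups.
-/

/-! ### Infinite words -/

namespace AWord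

variable {A X : Type*} [AddCommGroup A] [LinearOrder A] [DiscretelyOrdered A]

theorem ext' {u v : AWord A X} (hl : u.len = v.len) (h : u.letter = v.letter) : u = v := by
  cases u; cases v; simp_all

theorem eq_of_len_eq_zero {u v : AWord A X} (hu : u.len = 0) (hv : v.len = 0) : u = v := by
  have key : ∀ w : AWord A X, w.len = 0 → ∀ a, w.letter a = none := fun w hw a => by
    rw [← Option.not_isSome_iff_eq_none, w.isSome_letter_iff, hw]
    exact fun k => absurd (k.1.trans k.2) (not_le.mpr DiscretelyOrdered.unit_pos)
  exact ext' (hu.trans hv.symm) (funext fun a => by rw [key u hu, key v hv])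

variable [IsOrderedAddMonoid A]

@[simp] theorem len_concat (u v : AWord A X) : (u.concat v).len = u.len + v.len := rfl

@[simp] theorem len_inverse (u : AWord A X) : u.inverse.len = u.len := rfl

theorem letter_concat_of_le (u v : AWord A X) {a : A} (h : a ≤ u.len) :
    (u.concat v).letter a = u.letter a := if_pos h

theorem letter_concat_len_add (u v : AWord A X) {a : A} (h : 0 < a) :
    (u.concat v).letter (u.len + a) = v.letter a := by
  have h' : ¬ u.len + a ≤ u.len := by simpa using h
  simp [concat, h']

theorem letter_inverse (u : AWord A X) (a : A) :
    u.inverse.letter a = (u.letter (u.len + DiscretelyOrdered.unit - a)).map SignedLetter.inv :=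
  rfl

theorem map_inv_map_inv (o : Option (SignedLetter X)) :
    (o.map SignedLetter.inv).map SignedLetter.inv = o := by
  cases o <;> simp [SignedLetter.inv]

theorem inverse_inverse (u : AWord A X) : u.inverse.inverse = u := by
  refine ext' rfl (funext fun a => ?_)
  rw [letter_inverse, letter_inverse, map_inv_map_inv, len_inverse, sub_sub_cancel]

/-- If `com(u, v)` is shorter than `u`, then `u` and `v` differ right after it (the value `none` of
`v` beyond its end counts as a difference). -/
theorem IsCom.letter_ne {u v c : AWord A X} (h : IsCom u v c) (hu : c.len < u.len) :
    u.letter (c.len + DiscretelyOrdered.unit) ≠ v.letter (c.len + DiscretelyOrdered.unit) := by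
  obtain ⟨u', v', rfl, rfl, hd⟩ := h
  rw [letter_concat_len_add _ _ DiscretelyOrdered.unit_pos,
    letter_concat_len_add _ _ DiscretelyOrdered.unit_pos]
  have hs : (u'.letter DiscretelyOrdered.unit).isSome :=
    (u'.isSome_letter_iff _).mpr ⟨le_rfl, DiscretelyOrdered.unit_le_iff.mpr (by simpa using hu)⟩
  obtain ⟨x, hx⟩ := Option.isSome_iff_exists.mp hs
  exact fun he => hd x hx (he ▸ hx)

theorem IsCom.letter_eq {u v c : AWord A X} (h : IsCom u v c) {a : A} (ha : a ≤ c.len) :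
    u.letter a = v.letter a := by
  obtain ⟨u', v', rfl, rfl, -⟩ := h
  rw [letter_concat_of_le _ _ ha, letter_concat_of_le _ _ ha]

theorem IsCom.len_le {u v c : AWord A X} (h : IsCom u v c) : c.len ≤ u.len := by
  obtain ⟨u', v', rfl, rfl, -⟩ := h
  simpa using u'.len_nonneg

/-- The ultrametric inequality for longest common initial segments. -/
theorem IsCom.min_len_le {u v w c d e : AWord A X} (hc : IsCom u v c) (hd : IsCom v w d)
    (he : IsCom u w e) : min c.len d.len ≤ e.len := by
  by_contra! hlt
  have step : ∀ {b : A}, e.len < b → e.len + DiscretelyOrdered.unit ≤ b := fun hb => by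
    have := DiscretelyOrdered.unit_le _ (sub_pos.mpr hb)
    rwa [le_sub_iff_add_le'] at this
  obtain ⟨h1, h2⟩ := lt_min_iff.mp hlt
  exact he.letter_ne (h1.trans_le hc.len_le)
    ((hc.letter_eq (step h1)).trans (hd.letter_eq (step h2)))

end AWord

/-! ### Lengths in subgroups of `CDR(A, X)` -/

namespace CDREmbedding

section General

variable {A X G : Type*} [AddCommGroup A] [LinearOrder A] [IsOrderedAddMonoid A]
  [DiscretelyOrdered A] [Group G] (φ : CDREmbedding A X G)

theorem len_word_one : (φ.word 1).len = 0 := by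
  obtain ⟨c, u', v', h1, h2, -, h3⟩ := φ.word_mul 1 1
  rw [mul_one] at h3
  have e1 : (φ.word 1).len = c.len + u'.len := congrArg AWord.len h1
  have e2 : (φ.word 1).len = c.len + v'.len := congrArg AWord.len h2
  have e3 : (φ.word 1).len = u'.len + v'.len := congrArg AWord.len h3
  have hu : u'.len = c.len := add_right_cancel (e3.symm.trans e2)
  have e4 : (φ.word 1).len = c.len + c.len := by rw [e1, hu]
  by_contra hne
  -- The word `w` of `1` has length `2 |c|`, and both `w` and `w⁻¹` begin with `c`. So the two
  -- letters in the middle of `w` are inverse to each other, and `w` is not reduced.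
  have hpos : 0 < c.len := by
    refine lt_of_le_of_ne c.len_nonneg fun h => hne ?_
    rw [e4, ← h, add_zero]
  refine (φ.word_mem 1).1 c.len (DiscretelyOrdered.unit_le _ hpos)
    (by rw [e4]; exact lt_add_of_pos_left _ hpos) ?_
  have h4 : (φ.word 1).inverse.letter c.len = (φ.word 1).letter c.len := by
    rw [h1, AWord.letter_concat_of_le _ _ le_rfl]
    conv_rhs => rw [h2]
    rw [AWord.letter_concat_of_le _ _ le_rfl]
  rw [← h4, AWord.letter_inverse, AWord.map_inv_map_inv, e4]
  congr 1
  abel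

theorem word_inv (g : G) : φ.word g⁻¹ = (φ.word g).inverse := by
  obtain ⟨c, u', v', h1, h2, -, h3⟩ := φ.word_mul g⁻¹ g
  rw [inv_mul_cancel] at h3
  have e : u'.len + v'.len = 0 := (congrArg AWord.len h3).symm.trans φ.len_word_one
  obtain ⟨hu, hv⟩ := (add_eq_zero_iff_of_nonneg u'.len_nonneg v'.len_nonneg).mp e
  rw [AWord.eq_of_len_eq_zero hu hv, ← h2] at h1
  rw [← h1, AWord.inverse_inverse]

/-- The word `com(f, g)` exists, and its length is the Gromov product of `f` and `g`. -/
theorem exists_isCom (f g : G) : ∃ c, AWord.IsCom (φ.word f) (φ.word g) c ∧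
    c.len + c.len + (φ.word (f⁻¹ * g)).len = (φ.word f).len + (φ.word g).len := by
  obtain ⟨c, u', v', h1, h2, hd, h3⟩ := φ.word_mul f⁻¹ g
  rw [word_inv, AWord.inverse_inverse] at h1
  refine ⟨c, ⟨u', v', h1, h2, hd⟩, ?_⟩
  rw [h1, h2, h3]
  simp only [AWord.len_concat, AWord.len_inverse]
  abel

end General

/-! ### The integer length function `λ` -/

variable {n : ℕ} {X G : Type*} [Group G] (φ : CDREmbedding (RightLexZ n) X G)

theorem _root_.RightLexZ.coord_last_mono {n : ℕ} {a b : RightLexZ n} (h : a ≤ b) :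
    RightLexZ.coord (Fin.last n) a ≤ RightLexZ.coord (Fin.last n) b := by
  rcases h.lt_or_eq with h | rfl
  · obtain ⟨i, hi, hlt⟩ := RightLexZ.lt_iff.mp h
    rcases (Fin.le_last i).lt_or_eq with hl | rfl
    · exact (hi _ hl).le
    · exact hlt.le
  · exact le_rfl

theorem _root_.AWord.topLength_nonneg (w : AWord (RightLexZ n) X) : 0 ≤ w.topLength :=
  RightLexZ.coord_last_mono w.len_nonneg

/-- Twice the Gromov product of `f` and `g` with respect to `λ`. -/
def gromov (f g : G) : ℤ := φ.lam f + φ.lam g - φ.lam (f⁻¹ * g)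

theorem lam_nonneg (g : G) : 0 ≤ φ.lam g := (φ.word g).topLength_nonneg

theorem lam_one : φ.lam 1 = 0 := by
  simp [lam, AWord.topLength, φ.len_word_one]

theorem lam_inv (g : G) : φ.lam g⁻¹ = φ.lam g := by
  simp [lam, AWord.topLength, φ.word_inv]

theorem exists_isCom_gromov (f g : G) : ∃ c, AWord.IsCom (φ.word f) (φ.word g) c ∧
    φ.gromov f g = 2 * c.topLength := by
  obtain ⟨c, hc, h⟩ := φ.exists_isCom f g
  refine ⟨c, hc, ?_⟩
  have := congrArg (RightLexZ.coord (Fin.last n)) h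
  simp only [RightLexZ.coord_add] at this
  simp only [gromov, lam, AWord.topLength]
  omega

theorem gromov_nonneg (f g : G) : 0 ≤ φ.gromov f g := by
  obtain ⟨c, -, h⟩ := φ.exists_isCom_gromov f g
  have := c.topLength_nonneg
  omega

theorem gromov_comm (f g : G) : φ.gromov f g = φ.gromov g f := by
  rw [gromov, gromov, ← φ.lam_inv (f⁻¹ * g), mul_inv_rev, inv_inv, add_comm (φ.lam f)]

theorem min_gromov_le (f g h : G) : min (φ.gromov f g) (φ.gromov g h) ≤ φ.gromov f h := by
  obtain ⟨c, hc, h1⟩ := φ.exists_isCom_gromov f g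
  obtain ⟨d, hd, h2⟩ := φ.exists_isCom_gromov g h
  obtain ⟨e, he, h3⟩ := φ.exists_isCom_gromov f h
  rw [h1, h2, h3]
  rcases min_le_iff.mp (hc.min_len_le hd he) with hle | hle
  · exact min_le_of_left_le (by have := RightLexZ.coord_last_mono hle; simpa [AWord.topLength])
  · exact min_le_of_right_le (by have := RightLexZ.coord_last_mono hle; simpa [AWord.topLength])

theorem lam_mul_le (f g : G) : φ.lam (f * g) ≤ φ.lam f + φ.lam g := by
  have := φ.gromov_nonneg f⁻¹ g
  rw [gromov, inv_inv, lam_inv] at this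
  omega

theorem lam_mul_left {h : G} (hh : φ.lam h = 0) (g : G) : φ.lam (h * g) = φ.lam g := by
  have h1 := φ.lam_mul_le h g
  have h2 := φ.lam_mul_le h⁻¹ (h * g)
  rw [inv_mul_cancel_left, lam_inv] at h2
  omega

theorem lam_mul_right {h : G} (hh : φ.lam h = 0) (g : G) : φ.lam (g * h) = φ.lam g := by
  rw [← lam_inv, mul_inv_rev, lam_mul_left _ (by rwa [lam_inv]), lam_inv]

theorem gromov_mul_right {h : G} (hh : φ.lam h = 0) (f g : G) :
    φ.gromov f (g * h) = φ.gromov f g := by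
  rw [gromov, gromov, ← mul_assoc, lam_mul_right _ hh, lam_mul_right _ hh]

theorem gromov_mul_left {h : G} (hh : φ.lam h = 0) (f g : G) :
    φ.gromov (h * f) (h * g) = φ.gromov f g := by
  rw [gromov, gromov, lam_mul_left _ hh, lam_mul_left _ hh]
  congr 2
  group

/-! ### The set `P_Z` -/

variable {Z : Set G}

theorem lam_eq_zero_of_mem {h : G} (hh : h ∈ φ.zeroSubgroup Z) : φ.lam h = 0 := by
  refine Subgroup.closure_induction (p := fun x _ => φ.lam x = 0) (fun x hx => hx.2) φ.lam_one
    (fun x y _ _ hx hy => ?_) (fun x _ hx => ?_) hh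
  · rw [lam_mul_left _ hx, hy]
  · rw [lam_inv, hx]

theorem lam_pos_of_mem_plusPartPM {f : G} (hf : f ∈ φ.plusPartPM Z) : 0 < φ.lam f := by
  rcases hf with hf | hf
  · exact hf.2
  · rw [← lam_inv]; exact hf.2

theorem inv_mem_plusPartPM {f : G} (hf : f ∈ φ.plusPartPM Z) : f⁻¹ ∈ φ.plusPartPM Z := by
  rcases hf with hf | hf
  · exact Or.inr (by rwa [inv_inv])
  · exact Or.inl hf

theorem exists_eq_of_mem_of_not_mem {p : G} (hp : p ∈ φ.pregroupSet Z)
    (hp' : p ∉ φ.zeroSubgroup Z) : ∃ g ∈ φ.zeroSubgroup Z, ∃ f ∈ φ.plusPartPM Z,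
      ∃ h ∈ φ.zeroSubgroup Z, p = g * f * h :=
  hp.resolve_right hp'

theorem lam_double_coset {g f h : G} (hg : g ∈ φ.zeroSubgroup Z) (hh : h ∈ φ.zeroSubgroup Z) :
    φ.lam (g * f * h) = φ.lam f := by
  rw [lam_mul_right _ (φ.lam_eq_zero_of_mem hh), lam_mul_left _ (φ.lam_eq_zero_of_mem hg)]

theorem lam_pos_of_mem_of_not_mem {p : G} (hp : p ∈ φ.pregroupSet Z)
    (hp' : p ∉ φ.zeroSubgroup Z) : 0 < φ.lam p := by
  obtain ⟨g, hg, f, hf, h, hh, rfl⟩ := φ.exists_eq_of_mem_of_not_mem hp hp'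
  rw [lam_double_coset _ hg hh]
  exact φ.lam_pos_of_mem_plusPartPM hf

theorem mul_mem_pregroupSet_left {k p : G} (hk : k ∈ φ.zeroSubgroup Z)
    (hp : p ∈ φ.pregroupSet Z) : k * p ∈ φ.pregroupSet Z := by
  rcases hp with ⟨g, hg, f, hf, h, hh, rfl⟩ | hp
  · exact Or.inl ⟨k * g, mul_mem hk hg, f, hf, h, hh, by group⟩
  · exact Or.inr (mul_mem hk hp)

theorem mul_mem_pregroupSet_right {k p : G} (hk : k ∈ φ.zeroSubgroup Z)
    (hp : p ∈ φ.pregroupSet Z) : p * k ∈ φ.pregroupSet Z := by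
  rcases hp with ⟨g, hg, f, hf, h, hh, rfl⟩ | hp
  · exact Or.inl ⟨g, hg, f, hf, h * k, mul_mem hh hk, by group⟩
  · exact Or.inr (mul_mem hp hk)

theorem closure_pregroupSet (hgen : Subgroup.closure Z = ⊤) :
    Subgroup.closure (φ.pregroupSet Z) = ⊤ := by
  rw [eq_top_iff, ← hgen]
  refine Subgroup.closure_mono fun z hz => ?_
  rcases (φ.lam_nonneg z).eq_or_lt with h | h
  · exact Or.inr (Subgroup.subset_closure ⟨hz, h.symm⟩)
  · exact Or.inl ⟨1, one_mem _, z, Or.inl ⟨hz, h⟩, 1, one_mem _, by group⟩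

variable {φ}

theorem IsReducedSet.gromov_eq_zero (hred : φ.IsReducedSet Z) {f g h : G}
    (hf : f ∈ φ.plusPartPM Z) (hg : g ∈ φ.plusPartPM Z) (hfg : f ≠ g)
    (hh : h ∈ φ.zeroSubgroup Z) : φ.gromov f (h * g) = 0 := by
  obtain ⟨c, hc, e⟩ := φ.exists_isCom_gromov f (h * g)
  rw [e, hred.com_of_ne f hf g hg hfg h hh c hc, mul_zero]

theorem IsReducedSet.conj_mem_of_gromov_ne_zero (hred : φ.IsReducedSet Z) {f h : G}
    (hf : f ∈ φ.plusPartPM Z) (hh : h ∈ φ.zeroSubgroup Z) (hne : φ.gromov f (h * f) ≠ 0) :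
    f⁻¹ * h * f ∈ φ.zeroSubgroup Z := by
  obtain ⟨c, hc, e⟩ := φ.exists_isCom_gromov f (h * f)
  have := c.topLength_nonneg
  exact (hred.conj_mem f hf h hh c hc (by omega)).2

/-- If `λ` cancels in the product of two elements of `P_Z` outside `⟨Z_0⟩`, then the product is
in `⟨Z_0⟩`. -/
theorem IsReducedSet.mul_mem_zeroSubgroup_of_gromov_ne_zero (hred : φ.IsReducedSet Z) {p q : G}
    (hp : p ∈ φ.pregroupSet Z) (hp' : p ∉ φ.zeroSubgroup Z)
    (hq : q ∈ φ.pregroupSet Z) (hq' : q ∉ φ.zeroSubgroup Z) (hne : φ.gromov p⁻¹ q ≠ 0) :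
    p * q ∈ φ.zeroSubgroup Z := by
  obtain ⟨g₁, hg₁, f₁, hf₁, h₁, hh₁, rfl⟩ := φ.exists_eq_of_mem_of_not_mem hp hp'
  obtain ⟨g₂, hg₂, f₂, hf₂, h₂, hh₂, rfl⟩ := φ.exists_eq_of_mem_of_not_mem hq hq'
  have e : φ.gromov (g₁ * f₁ * h₁)⁻¹ (g₂ * f₂ * h₂) = φ.gromov f₁⁻¹ (h₁ * g₂ * f₂) := by
    rw [φ.gromov_mul_right (φ.lam_eq_zero_of_mem hh₂),
      ← φ.gromov_mul_left (φ.lam_eq_zero_of_mem hh₁), gromov_comm,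
      ← φ.gromov_mul_right (φ.lam_eq_zero_of_mem hg₁), gromov_comm]
    congr 1 <;> group
  rw [e] at hne
  have hf : f₁⁻¹ = f₂ := by
    by_contra hf
    exact hne (hred.gromov_eq_zero (φ.inv_mem_plusPartPM hf₁) hf₂ hf (mul_mem hh₁ hg₂))
  subst hf
  have := hred.conj_mem_of_gromov_ne_zero hf₂ (mul_mem hh₁ hg₂) hne
  rw [inv_inv] at this
  convert mul_mem (mul_mem hg₁ this) hh₂ using 1
  group

/-- Two elements of `P_Z` outside `⟨Z_0⟩` can be multiplied in `P_Z` only if their product is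
in `⟨Z_0⟩`. -/
theorem IsReducedSet.mul_mem_zeroSubgroup_of_mem_pregroupSet (hred : φ.IsReducedSet Z) {p q : G}
    (hp : p ∈ φ.pregroupSet Z) (hp' : p ∉ φ.zeroSubgroup Z)
    (hq : q ∈ φ.pregroupSet Z) (hq' : q ∉ φ.zeroSubgroup Z) (hpq : p * q ∈ φ.pregroupSet Z) :
    p * q ∈ φ.zeroSubgroup Z := by
  by_contra hpq'
  have h0 : φ.gromov p⁻¹ q = 0 := by
    by_contra hne
    exact hpq' (hred.mul_mem_zeroSubgroup_of_gromov_ne_zero hp hp' hq hq' hne)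
  have hpos := φ.lam_pos_of_mem_of_not_mem hp hp'
  have hqos := φ.lam_pos_of_mem_of_not_mem hq hq'
  rw [gromov, inv_inv, lam_inv] at h0
  -- Without cancellation, `p` is an initial segment of `p * q` at the level of `λ`.
  have h1 : φ.gromov (p * q) p = 2 * φ.lam p := by
    rw [gromov_comm, gromov, inv_mul_cancel_left]
    omega
  obtain ⟨g₁, hg₁, f₁, hf₁, h₁, hh₁, e₁⟩ := φ.exists_eq_of_mem_of_not_mem hp hp'
  obtain ⟨g₃, hg₃, f₃, hf₃, h₃, hh₃, e₃⟩ := φ.exists_eq_of_mem_of_not_mem hpq hpq'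
  have e : φ.gromov (p * q) p = φ.gromov f₃ (g₃⁻¹ * g₁ * f₁) := by
    rw [e₃, gromov_comm, φ.gromov_mul_right (φ.lam_eq_zero_of_mem hh₃), e₁, gromov_comm,
      φ.gromov_mul_right (φ.lam_eq_zero_of_mem hh₁),
      ← φ.gromov_mul_left (φ.lam_eq_zero_of_mem (inv_mem hg₃))]
    congr 1 <;> group
  have hf : f₃ = f₁ := by
    by_contra hf
    rw [e, hred.gromov_eq_zero hf₃ hf₁ hf (mul_mem (inv_mem hg₃) hg₁)] at h1
    omega
  have l₁ : φ.lam p = φ.lam f₁ := by rw [e₁, lam_double_coset _ hg₁ hh₁]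
  have l₃ : φ.lam (p * q) = φ.lam f₃ := by rw [e₃, lam_double_coset _ hg₃ hh₃]
  rw [hf] at l₃
  omega

/-! ### The pregroup and its reduced sequences -/

theorem pregroupMul_eq_some_iff {x y z : φ.pregroupSet Z} :
    (φ.pregroupMul Z).mul x y = some z ↔ (x : G) * y = z := by
  unfold pregroupMul PartialMultiplication.induced
  constructor
  · intro h
    dsimp only at h
    split_ifs at h with hm
    exact congrArg Subtype.val (Option.some.inj h)
  · intro h
    have hm : (x : G) * y ∈ φ.pregroupSet Z := h ▸ z.2
    simp only [dif_pos hm, Option.some.injEq]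
    exact Subtype.ext h

theorem isSome_pregroupMul_iff {x y : φ.pregroupSet Z} :
    ((φ.pregroupMul Z).mul x y).isSome ↔ (x : G) * y ∈ φ.pregroupSet Z := by
  rw [Option.isSome_iff_exists]
  simp only [pregroupMul_eq_some_iff]
  exact ⟨fun ⟨z, hz⟩ => hz ▸ z.2, fun h => ⟨⟨_, h⟩, rfl⟩⟩

theorem pregroupMul_eq_none_iff {x y : φ.pregroupSet Z} :
    (φ.pregroupMul Z).mul x y = none ↔ (x : G) * y ∉ φ.pregroupSet Z := by
  rw [← isSome_pregroupMul_iff, Option.not_isSome_iff_eq_none]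

theorem IsReducedSet.isPregroup (hred : φ.IsReducedSet Z) : (φ.pregroupMul Z).IsPregroup where
  inv_inv x := Subtype.ext (inv_inv (x : G))
  one_mul x := pregroupMul_eq_some_iff.mpr (_root_.one_mul (x : G))
  mul_one x := pregroupMul_eq_some_iff.mpr (_root_.mul_one (x : G))
  inv_mul x := pregroupMul_eq_some_iff.mpr (inv_mul_cancel (x : G))
  mul_inv x := pregroupMul_eq_some_iff.mpr (mul_inv_cancel (x : G))
  mul_inv_rev x y z h := pregroupMul_eq_some_iff.mpr <| by
    change (y : G)⁻¹ * (x : G)⁻¹ = (z : G)⁻¹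
    rw [← pregroupMul_eq_some_iff.mp h, _root_.mul_inv_rev]
  assoc x y z a b hxy hyz := by
    have ha := pregroupMul_eq_some_iff.mp hxy
    have hb := pregroupMul_eq_some_iff.mp hyz
    ext t
    rw [pregroupMul_eq_some_iff, pregroupMul_eq_some_iff, ← ha, ← hb, mul_assoc]
  four w x y z a b c hwx hxy hyz := by
    have ha := pregroupMul_eq_some_iff.mp hwx
    have hb := pregroupMul_eq_some_iff.mp hxy
    have hc := pregroupMul_eq_some_iff.mp hyz
    rw [isSome_pregroupMul_iff, isSome_pregroupMul_iff]
    by_cases hx : (x : G) ∈ φ.zeroSubgroup Z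
    · right
      rw [← hb, mul_assoc, hc]
      exact φ.mul_mem_pregroupSet_left hx c.2
    by_cases hy : (y : G) ∈ φ.zeroSubgroup Z
    · exact Or.inl (φ.mul_mem_pregroupSet_right hy a.2)
    left
    rw [← ha, mul_assoc]
    exact φ.mul_mem_pregroupSet_right
      (hred.mul_mem_zeroSubgroup_of_mem_pregroupSet x.2 hx y.2 hy (hb ▸ b.2)) w.2

theorem not_mem_zeroSubgroup_of_mul_not_mem {p q : G} (hp : p ∈ φ.pregroupSet Z)
    (hq : q ∈ φ.pregroupSet Z) (hpq : p * q ∉ φ.pregroupSet Z) :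
    p ∉ φ.zeroSubgroup Z ∧ q ∉ φ.zeroSubgroup Z :=
  ⟨fun h => hpq (φ.mul_mem_pregroupSet_left h hq), fun h => hpq (φ.mul_mem_pregroupSet_right h hp)⟩

/-- The length function is additive along reduced sequences. -/
theorem IsReducedSet.lam_prod_of_isReducedSeq (hred : φ.IsReducedSet Z) :
    ∀ L : List (φ.pregroupSet Z), (φ.pregroupMul Z).IsReducedSeq L →
      φ.lam (L.map fun p : φ.pregroupSet Z => (p : G)).prod =
        (L.map fun p : φ.pregroupSet Z => φ.lam (p : G)).sum
  | [], _ => by simpa using φ.lam_one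
  | [p], _ => by simp
  | p :: q :: L, hL => by
    obtain ⟨hpq, hqL⟩ := List.isChain_cons_cons.mp hL
    have ih₁ := hred.lam_prod_of_isReducedSeq (q :: L) hqL
    have ih₂ := hred.lam_prod_of_isReducedSeq L hqL.tail
    rw [pregroupMul_eq_none_iff] at hpq
    obtain ⟨hp, hq⟩ := not_mem_zeroSubgroup_of_mul_not_mem p.2 q.2 hpq
    have h0 : φ.gromov (p : G)⁻¹ q = 0 := by
      by_contra hne
      exact hpq (Or.inr (hred.mul_mem_zeroSubgroup_of_gromov_ne_zero p.2 hp q.2 hq hne))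
    have hqpos := φ.lam_pos_of_mem_of_not_mem q.2 hq
    simp only [List.map_cons, List.prod_cons, List.sum_cons] at ih₁ ⊢
    set r : G := (L.map fun p : φ.pregroupSet Z => (p : G)).prod
    -- The remaining product begins with `q`, so cancellation with it would be cancellation
    -- with `q`.
    have h1 : φ.gromov (q * r) q = 2 * φ.lam q := by
      rw [gromov_comm, gromov, inv_mul_cancel_left]
      omega
    have h2 := φ.min_gromov_le (p : G)⁻¹ (q * r) q
    have h3 := φ.gromov_nonneg (p : G)⁻¹ (q * r)
    have h4 : φ.gromov (p : G)⁻¹ (q * r) = 0 := by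
      rcases min_le_iff.mp h2 with h | h <;> omega
    rw [gromov, inv_inv, lam_inv] at h4
    omega

/-! ### The universal group -/

variable (φ Z) in
/-- The homomorphism `U(P_Z) → G` that extends the inclusion. -/
noncomputable def universalHom : (φ.pregroupMul Z).UniversalGroup →* G :=
  PresentedGroup.toGroup (f := fun p : φ.pregroupSet Z => (p : G)) <| by
    rintro _ ⟨x, y, z, h, rfl⟩
    simp [pregroupMul_eq_some_iff.mp h]

theorem universalHom_toUniversal (p : φ.pregroupSet Z) :
    universalHom φ Z ((φ.pregroupMul Z).toUniversal p) = p :=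
  PresentedGroup.toGroup.of _

theorem toUniversal_mul {x y z : φ.pregroupSet Z} (h : (φ.pregroupMul Z).mul x y = some z) :
    (φ.pregroupMul Z).toUniversal x * (φ.pregroupMul Z).toUniversal y =
      (φ.pregroupMul Z).toUniversal z :=
  PresentedGroup.mk_eq_mk_of_mul_inv_mem ⟨x, y, z, h, rfl⟩

theorem toUniversal_one : (φ.pregroupMul Z).toUniversal (φ.pregroupMul Z).one = 1 := by
  have h : (φ.pregroupMul Z).mul (φ.pregroupMul Z).one (φ.pregroupMul Z).one =
      some (φ.pregroupMul Z).one := pregroupMul_eq_some_iff.mpr (mul_one (1 : G))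
  exact mul_eq_left.mp (toUniversal_mul h)

theorem toUniversal_inv (x : φ.pregroupSet Z) : ((φ.pregroupMul Z).toUniversal x)⁻¹ =
    (φ.pregroupMul Z).toUniversal ((φ.pregroupMul Z).inv x) := by
  have h : (φ.pregroupMul Z).mul x ((φ.pregroupMul Z).inv x) = some (φ.pregroupMul Z).one :=
    pregroupMul_eq_some_iff.mpr (mul_inv_cancel (x : G))
  exact inv_eq_of_mul_eq_one_right ((toUniversal_mul h).trans toUniversal_one)

theorem exists_list_prod_toUniversal (u : (φ.pregroupMul Z).UniversalGroup) :
    ∃ L : List (φ.pregroupSet Z), (L.map (φ.pregroupMul Z).toUniversal).prod = u := by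
  have hu : u ∈ Subgroup.closure (Set.range (φ.pregroupMul Z).toUniversal) := by
    have := PresentedGroup.closure_range_of (φ.pregroupMul Z).relators
    exact this ▸ Subgroup.mem_top u
  induction hu using Subgroup.closure_induction with
  | mem x hx =>
    obtain ⟨p, rfl⟩ := hx
    exact ⟨[p], by simp⟩
  | one => exact ⟨[], rfl⟩
  | mul x y _ _ hx hy =>
    obtain ⟨L, rfl⟩ := hx
    obtain ⟨M, rfl⟩ := hy
    exact ⟨L ++ M, by simp⟩
  | inv x _ hx =>
    obtain ⟨L, rfl⟩ := hx
    refine ⟨(L.map (φ.pregroupMul Z).inv).reverse, ?_⟩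
    rw [List.prod_inv_reverse, List.map_reverse, List.map_map, List.map_map]
    congr 3
    exact funext fun p => (toUniversal_inv p).symm

/-- Every element of the universal group is the product of a reduced sequence: a shortest
sequence with this product. -/
theorem exists_isReducedSeq (u : (φ.pregroupMul Z).UniversalGroup) :
    ∃ L : List (φ.pregroupSet Z), (φ.pregroupMul Z).IsReducedSeq L ∧
      (L.map (φ.pregroupMul Z).toUniversal).prod = u := by
  obtain ⟨L, hL, hmin⟩ := exists_minimalFor_of_wellFoundedLT
    (fun L : List (φ.pregroupSet Z) => (L.map (φ.pregroupMul Z).toUniversal).prod = u)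
    List.length (exists_list_prod_toUniversal u)
  refine ⟨L, ?_, hL⟩
  rw [PartialMultiplication.IsReducedSeq, List.isChain_iff_forall_rel_of_append_cons_cons]
  rintro x y M N rfl
  by_contra hxy
  obtain ⟨z, hz⟩ := Option.ne_none_iff_exists'.mp hxy
  have h := hmin (j := M ++ z :: N) (by
    rw [← hL]
    simp [← toUniversal_mul hz, mul_assoc]) (by simp)
  simp at h

theorem IsReducedSet.universalHom_injective (hred : φ.IsReducedSet Z) :
    Function.Injective (universalHom φ Z) := by
  rw [injective_iff_map_eq_one]
  intro u hu
  obtain ⟨L, hL, rfl⟩ := exists_isReducedSeq u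
  have hprod : (L.map fun p : φ.pregroupSet Z => (p : G)).prod = 1 := by
    rw [← hu, map_list_prod, List.map_map]
    congr 2
    exact funext fun p => (universalHom_toUniversal p).symm
  match L, hL, hprod with
  | [], _, _ => rfl
  | [p], _, hprod =>
    have hp : p = (φ.pregroupMul Z).one := Subtype.ext (by simpa using hprod : (p : G) = 1)
    simp [hp, toUniversal_one]
  | p :: q :: L, hL, hprod =>
    have hsum := hred.lam_prod_of_isReducedSeq _ hL
    rw [hprod, lam_one, List.map_cons, List.sum_cons] at hsum
    have hpq := pregroupMul_eq_none_iff.mp (List.isChain_cons_cons.mp hL).1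
    have hpos := φ.lam_pos_of_mem_of_not_mem p.2
      (not_mem_zeroSubgroup_of_mul_not_mem p.2 q.2 hpq).1
    have hnonneg : 0 ≤ ((q :: L).map fun p : φ.pregroupSet Z => φ.lam (p : G)).sum := by
      refine List.sum_nonneg fun a ha => ?_
      obtain ⟨r, -, rfl⟩ := List.mem_map.mp ha
      exact φ.lam_nonneg _
    omega

theorem universalHom_surjective (hgen : Subgroup.closure Z = ⊤) :
    Function.Surjective (universalHom φ Z) := by
  rw [← MonoidHom.range_eq_top, eq_top_iff, ← φ.closure_pregroupSet hgen, Subgroup.closure_le]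
  exact fun p hp => ⟨_, universalHom_toUniversal ⟨p, hp⟩⟩

end CDREmbedding

theorem mainTheorem4 {n : ℕ} {X G : Type*} [Group G]
    (φ : CDREmbedding (RightLexZ n) X G) (Z : Set G)
    (hgen : Subgroup.closure Z = ⊤) (hred : φ.IsReducedSet Z) :
    (φ.pregroupMul Z).IsPregroup ∧
    (∃ e : (φ.pregroupMul Z).UniversalGroup ≃* G,
      ∀ p : φ.pregroupSet Z, e ((φ.pregroupMul Z).toUniversal p) = (p : G)) ∧
    (∀ (g : G) (L : List (φ.pregroupSet Z)), (φ.pregroupMul Z).IsReducedSeq L →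
      (L.map fun p : φ.pregroupSet Z => (p : G)).prod = g →
      φ.lam g = (L.map fun p : φ.pregroupSet Z => φ.lam (p : G)).sum) := by
  refine ⟨hred.isPregroup, ⟨MulEquiv.ofBijective (CDREmbedding.universalHom φ Z)
    ⟨hred.universalHom_injective, CDREmbedding.universalHom_surjective hgen⟩,
    CDREmbedding.universalHom_toUniversal⟩, ?_⟩
  rintro _ L hL rfl
  exact hred.lam_prod_of_isReducedSeq L hL
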